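/- Conventions. A Hilbertian space is a complex topological vector space $H$ that is isomorphic, as a topological vector space, to a Hilbert space; a scalar product on $H$ is admissible if it makes $H$ a Hilbert space with the given topology. $H^*$ denotes the space of continuous anti-linear functionals on $H$. A Hilbertian von Neumann category $\mathcal C$ is an additive subcategory of the category of Hilbertian spaces and continuous linear maps (its objects may carry additional structure) such that: (1) for every object $H$ the dual $H^*$ is an object, and there is an isomorphism $\theta:H\to H^*$ in $\mathcal C$ such that $\langle x,y\rangle=\theta(x)(y)$ is an admissible scalar product on $H$; (2) the canonical isomorphism $s_H:H\to H^{**}$, $s_H(x)(\psi)=\overline{\psi(x)}$, belongs to $\mathcal C$; (3) the adjoint $f^*:Y^*\to X^*$, $\psi\mapsto\psi\circ f$, of any morphism $f:X\to Y$ of $\mathcal C$ belongs to $\mathcal C$; (4) the kernel of any morphism of $\mathcal C$ and its inclusion belong to $\mathcal C$; (5) $\hom_{\mathcal C}(X,Y)$ is a linear subspace of the space of continuous linear maps $X\to Y$, closed in the weak operator topology. A closed $\mathcal C$-submodule of $H$ is a closed subspace of $H$ that, together with its inclusion, belongs to $\mathcal C$. $\mathcal C$ is finite if for every object $H$ the only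 closed $\mathcal C$-submodule of $H$ isomorphic to $H$ in $\mathcal C$ is $H$ itself. A form on $H$ is a morphism $\phi:H\to H^*$ of $\mathcal C$; put $\langle x,y\rangle_\phi=\phi(x)(y)$. It is Hermitian if $\phi=\phi^*\circ s_H$, non-degenerate if it is an isomorphism in $\mathcal C$, positively definite if $\langle x,x\rangle_\phi$ is a positive real number for all $x\neq0$, and negatively definite if $-\phi$ is positively definite. Its restriction to a closed $\mathcal C$-submodule $\iota:L\to H$ is $\phi|_L=\iota^*\circ\phi\circ\iota$. Forms $\phi_1$ on $H_1$ and $\phi_2$ on $H_2$ are congruent if $\phi_1=f^*\circ\phi_2\circ f$ for some isomorphism $f:H_1\to H_2$ in $\mathcal C$. Proposition 2.10. Let $\phi:H\to H^*$ be a non-degenerate Hermitian form in a finite von Neumann category $\mathcal C$. Then there is a decomposition $H=H_+\oplus H_-$ into closed $\mathcal C$-submodules that are orthogonal with respect to $\langle\ ,\ \rangle_\phi$ and such that $\phi|_{H_+}$ is positively definite and $\phi|_{H_-}$ is negatively definite. This decomposition is unique in the following sense: if $H=H_+\oplus H_-$ and $H=H'_+\oplus H'_-$ are two such decompositions, then $H_+$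 is isomorphic to $H'_+$ and $H_-$ is isomorphic to $H'_-$ in $\mathcal C$; moreover, $\phi|_{H_+}$ is congruent to $\phi|_{H'_+}$ and $\phi|_{H_-}$ is congruent to $\phi|_{H'_-}$. -/

import Mathlib

open CategoryTheory CategoryTheory.Limits

universe u v

/-- A Hilbertian space: a complex topological vector space that is isomorphic, as a topological
vector space, to a Hilbert space. No scalar product is chosen. -/
structure HilbertianSpace where
  carrier : Type v
  [addCommGroup : AddCommGroup carrier]
  [module : Module ℂ carrier]
  [topologicalSpace : TopologicalSpace carrier]
  [isTopologicalAddGroup : IsTopologicalAddGroup carrier]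
  [continuousSMul : ContinuousSMul ℂ carrier]
  exists_hilbert : ∃ (E : Type v) (_ : NormedAddCommGroup E) (_ : InnerProductSpace ℂ E)
    (_ : CompleteSpace E), Nonempty (carrier ≃L[ℂ] E)

namespace HilbertianSpace

instance : CoeSort HilbertianSpace.{v} (Type v) := ⟨HilbertianSpace.carrier⟩

attribute [instance] addCommGroup module topologicalSpace isTopologicalAddGroup continuousSMul

/-- The dual `H^*`: continuous anti-linear functionals on `H`, with the pointwise vector space
structure and the strong topology (uniform convergence on bounded sets). -/
abbrev AntiDual (H : HilbertianSpace.{v}) : Type v := H →L⋆[ℂ] ℂ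

/-- An admissible scalar product on `H`: one that is the pull-back of the scalar product of a
Hilbert space `E` under an isomorphism `H ≃ E` of topological vector spaces. The scalar product
`B` is linear in its first and anti-linear in its second argument, Mathlib's `inner` has the
opposite convention. -/
def IsAdmissible (H : HilbertianSpace.{v}) (B : H → H → ℂ) : Prop :=
  ∃ (E : Type v) (_ : NormedAddCommGroup E) (_ : InnerProductSpace ℂ E) (_ : CompleteSpace E)
    (e : H ≃L[ℂ] E), ∀ x y : H, B x y = inner ℂ (e y) (e x)

end HilbertianSpace

set_option linter.checkUnivs false in
/-- A category of Hilbertian spaces, possibly with additional structure: every object has an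
underlying Hilbertian space (distinct objects may have the same one), and the morphisms form a
linear subspace of the space of continuous linear maps. -/
structure HilbertianCategory where
  Obj : Type u
  space : Obj → HilbertianSpace.{v}
  homSpace : ∀ X Y : Obj, Submodule ℂ (space X →L[ℂ] space Y)
  id_mem : ∀ X, ContinuousLinearMap.id ℂ (space X) ∈ homSpace X X
  comp_mem : ∀ {X Y Z : Obj} {f : space X →L[ℂ] space Y} {g : space Y →L[ℂ] space Z},
    f ∈ homSpace X Y → g ∈ homSpace Y Z → g.comp f ∈ homSpace X Z

namespace HilbertianCategory

variable (C : HilbertianCategory.{u, v})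

instance category : Category.{v, u} C.Obj where
  Hom X Y := C.homSpace X Y
  id X := ⟨ContinuousLinearMap.id ℂ (C.space X), C.id_mem X⟩
  comp f g := ⟨g.1.comp f.1, C.comp_mem f.2 g.2⟩

instance preadditive : Preadditive C.Obj where
  homGroup X Y := inferInstanceAs (AddCommGroup (C.homSpace X Y))
  add_comp _ _ _ f f' g := Subtype.ext (ContinuousLinearMap.comp_add g.1 f.1 f'.1)
  comp_add _ _ _ f g g' := Subtype.ext (ContinuousLinearMap.add_comp g.1 g'.1 f.1)

variable {C}

/-- The continuous linear map underlying a morphism. -/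
def toCLM {X Y : C.Obj} (f : X ⟶ Y) : C.space X →L[ℂ] C.space Y := Subtype.val f

/-- A closed `C`-submodule of `X`: an object of `C` with a morphism of `C` into `X` that
identifies it, as a topological vector space, with a closed subspace of `X`. -/
structure ClosedSubmodule (X : C.Obj) where
  obj : C.Obj
  incl : obj ⟶ X
  isClosedEmbedding_incl : Topology.IsClosedEmbedding (toCLM incl)

/-- The closed subspace of `X` given by a closed `C`-submodule. -/
def ClosedSubmodule.subspace {X : C.Obj} (S : ClosedSubmodule X) : Submodule ℂ (C.space X) :=
  LinearMap.range (toCLM S.incl).toLinearMap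

/-- An object is finite if it is the only closed `C`-submodule of itself that is isomorphic
to it in `C`. -/
def IsFiniteObj (X : C.Obj) : Prop :=
  ∀ S : ClosedSubmodule X, Nonempty (S.obj ≅ X) → S.subspace = ⊤

end HilbertianCategory

set_option linter.checkUnivs false in
open HilbertianCategory in
/-- A Hilbertian von Neumann category. -/
structure VonNeumannCategory where
  cat : HilbertianCategory.{u, v}
  /-- The category is additive. -/
  hasFiniteBiproducts : HasFiniteBiproducts cat.Obj
  /-- The dual space of every object is an object. -/
  dual : cat.Obj → cat.Obj
  /-- The identification of the space underlying `dual X` with the dual of the space of `X`. -/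
  dualEquiv : ∀ X : cat.Obj, cat.space (dual X) ≃L[ℂ] (cat.space X).AntiDual
  /-- Every object is isomorphic to its dual through an admissible scalar product. -/
  exists_admissible : ∀ X : cat.Obj, ∃ θ : X ≅ dual X,
    (cat.space X).IsAdmissible fun x y => dualEquiv X (toCLM θ.hom x) y
  /-- The canonical isomorphism `s : X ⟶ X^**`, `x ↦ (ψ ↦ conj (ψ x))`, belongs to the category. -/
  toBidual : ∀ X : cat.Obj, X ⟶ dual (dual X)
  toBidual_apply : ∀ (X : cat.Obj) (x : cat.space X) (ψ : cat.space (dual X)),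
    dualEquiv (dual X) (toCLM (toBidual X) x) ψ = star (dualEquiv X ψ x)
  /-- The adjoint `f^* : Y^* ⟶ X^*`, `ψ ↦ ψ ∘ f`, of a morphism belongs to the category. -/
  dualMap : ∀ {X Y : cat.Obj}, (X ⟶ Y) → (dual Y ⟶ dual X)
  dualMap_apply : ∀ {X Y : cat.Obj} (f : X ⟶ Y) (ψ : cat.space (dual Y)) (x : cat.space X),
    dualEquiv X (toCLM (dualMap f) ψ) x = dualEquiv Y ψ (toCLM f x)
  /-- The kernel of a morphism and its inclusion belong to the category. -/
  exists_kernel : ∀ {X Y : cat.Obj} (f : X ⟶ Y), ∃ K : ClosedSubmodule X,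
    K.subspace = LinearMap.ker (toCLM f).toLinearMap
  /-- The morphisms form a weakly closed subspace of the continuous linear maps. -/
  isClosed_homSpace : ∀ X Y : cat.Obj,
    IsClosed {f : cat.space X →WOT[ℂ] cat.space Y | f.toCLM ∈ cat.homSpace X Y}

namespace VonNeumannCategory

open HilbertianCategory

/-- A von Neumann category is finite if all its objects are finite. -/
def IsFinite (C : VonNeumannCategory.{u, v}) : Prop := ∀ X : C.cat.Obj, IsFiniteObj X

variable {C : VonNeumannCategory.{u, v}}

/-- The transpose `φ^† = φ^* ∘ s` of a form `φ : X ⟶ X^*`. -/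
def transpose {X : C.cat.Obj} (φ : X ⟶ C.dual X) : X ⟶ C.dual X := C.toBidual X ≫ C.dualMap φ

/-- A form is Hermitian if it equals its transpose. -/
def IsHermitian {X : C.cat.Obj} (φ : X ⟶ C.dual X) : Prop := transpose φ = φ

/-- A form is non-degenerate if it is an isomorphism in `C`. -/
def IsNondegenerate {X : C.cat.Obj} (φ : X ⟶ C.dual X) : Prop := IsIso φ

/-- The scalar product `⟨x, y⟩_φ = φ(x)(y)` determined by a form `φ`. -/
noncomputable def pairing {X : C.cat.Obj} (φ : X ⟶ C.dual X) (x y : C.cat.space X) : ℂ := C.dualEquiv X (toCLM φ x) y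

/-- A form is positively definite if `⟨x, x⟩_φ` is a positive real number for all `x ≠ 0`. -/
def IsPosDef {X : C.cat.Obj} (φ : X ⟶ C.dual X) : Prop :=
  ∀ x : C.cat.space X, x ≠ 0 → ∃ r : ℝ, 0 < r ∧ pairing φ x x = r

/-- A form `φ` is negatively definite if `-φ` is positively definite. -/
def IsNegDef {X : C.cat.Obj} (φ : X ⟶ C.dual X) : Prop := IsPosDef (-φ)

/-- Two forms are congruent if an isomorphism of `C` carries one into the other. -/
def Congruent {X Y : C.cat.Obj} (φ : X ⟶ C.dual X) (ψ : Y ⟶ C.dual Y) : Prop :=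
  ∃ f : X ≅ Y, φ = f.hom ≫ ψ ≫ C.dualMap f.hom

/-- The restriction of a form to a closed `C`-submodule. -/
def restrict {X : C.cat.Obj} (φ : X ⟶ C.dual X) (S : ClosedSubmodule X) : S.obj ⟶ C.dual S.obj :=
  S.incl ≫ φ ≫ C.dualMap S.incl

/-- `X = P ⊕ N` is a decomposition into closed `C`-submodules, orthogonal with respect to `φ`,
such that `φ` is positively definite on `P` and negatively definite on `N`. -/
structure IsPosNegDecomposition {X : C.cat.Obj} (φ : X ⟶ C.dual X) (P N : ClosedSubmodule X) :
    Prop where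
  isCompl : IsCompl P.subspace N.subspace
  orthogonal : ∀ x ∈ P.subspace, ∀ y ∈ N.subspace, pairing φ x y = 0
  posDef : IsPosDef (restrict φ P)
  negDef : IsNegDef (restrict φ N)

end VonNeumannCategory

namespace VonNeumannCategory

open HilbertianCategory ContinuousLinearMap

variable {C : VonNeumannCategory.{u, v}} {X Y Z : C.cat.Obj}

/-! Realise an admissible scalar product on a Hilbert space `E`. The form becomes an invertible
self-adjoint operator `T`, and the endomorphisms of the object become a norm-closed star subalgebra
of the bounded operators on `E`, so continuous functional calculus stays inside the category. As 0
is not in the spectrum, the indicator of the positive axis is continuous there; it yields the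
projection that splits the object (`exists_isPosNegDecomposition`).

For uniqueness, project one positive part to another along the negative part. This does not decrease
the form, so it is a closed embedding. The composite of two such maps in opposite directions embeds
an object in itself, and finiteness makes it surjective (`nonempty_iso`). Closed embeddings split
(`exists_retraction`), so bijectivity gives an isomorphism in the category.

Congruence is then automatic: the square root of its operator carries a positive non-degenerate form
to any admissible scalar product. The negative parts are the positive parts of the negated form. -/

@[simp] lemma toCLM_comp (f : X ⟶ Y) (g : Y ⟶ Z) (x : C.cat.space X) :
    toCLM (f ≫ g) x = toCLM g (toCLM f x) := rfl

@[simp] lemma toCLM_id (x : C.cat.space X) : toCLM (𝟙 X) x = x := rfl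

@[simp] lemma toCLM_neg (f : X ⟶ Y) (x : C.cat.space X) : toCLM (-f) x = -toCLM f x := rfl

@[simp] lemma toCLM_hom_inv (f : X ≅ Y) (x : C.cat.space X) :
    toCLM f.inv (toCLM f.hom x) = x := by
  rw [← toCLM_comp, f.hom_inv_id, toCLM_id]

@[simp] lemma toCLM_inv_hom (f : X ≅ Y) (y : C.cat.space Y) :
    toCLM f.hom (toCLM f.inv y) = y := by
  rw [← toCLM_comp, f.inv_hom_id, toCLM_id]

lemma hom_ext {f g : X ⟶ Y} (h : ∀ x, toCLM f x = toCLM g x) : f = g :=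
  Subtype.ext (ContinuousLinearMap.ext h)

lemma bijective_toCLM (f : X ⟶ Y) [IsIso f] : Function.Bijective (toCLM f) :=
  Function.bijective_iff_has_inverse.2
    ⟨toCLM (inv f), toCLM_hom_inv (asIso f), toCLM_inv_hom (asIso f)⟩

/-! ### Duality, pairings and congruence -/

lemma dual_ext {ψ χ : C.cat.space (C.dual X)}
    (h : ∀ x, C.dualEquiv X ψ x = C.dualEquiv X χ x) : ψ = χ :=
  (C.dualEquiv X).injective (ContinuousLinearMap.ext h)

lemma form_ext {a b : X ⟶ C.dual X} (h : ∀ x y, pairing a x y = pairing b x y) : a = b :=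
  hom_ext fun x => dual_ext (h x)

lemma dualMap_id : C.dualMap (𝟙 X) = 𝟙 (C.dual X) :=
  hom_ext fun ψ => dual_ext fun x => by rw [C.dualMap_apply]; rfl

lemma dualMap_comp (f : X ⟶ Y) (g : Y ⟶ Z) :
    C.dualMap (f ≫ g) = C.dualMap g ≫ C.dualMap f :=
  hom_ext fun ψ => dual_ext fun x => by
    rw [C.dualMap_apply, toCLM_comp, toCLM_comp, C.dualMap_apply, C.dualMap_apply]

instance (f : X ⟶ Y) [IsIso f] : IsIso (C.dualMap f) :=
  ⟨C.dualMap (inv f), by rw [← dualMap_comp, IsIso.inv_hom_id, dualMap_id],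
    by rw [← dualMap_comp, IsIso.hom_inv_id, dualMap_id]⟩

@[simp] lemma pairing_pullback (f : X ⟶ Y) (a : Y ⟶ C.dual Y) (x y : C.cat.space X) :
    pairing (f ≫ a ≫ C.dualMap f) x y = pairing a (toCLM f x) (toCLM f y) := by
  simp [pairing, C.dualMap_apply]

lemma pairing_restrict (a : X ⟶ C.dual X) (S : ClosedSubmodule X) (x y : C.cat.space S.obj) :
    pairing (restrict a S) x y = pairing a (toCLM S.incl x) (toCLM S.incl y) :=
  pairing_pullback _ _ _ _

lemma pairing_neg (a : X ⟶ C.dual X) (x y : C.cat.space X) :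
    pairing (-a) x y = -pairing a x y := by
  simp [pairing]

lemma pairing_add_left (a : X ⟶ C.dual X) (x x' y : C.cat.space X) :
    pairing a (x + x') y = pairing a x y + pairing a x' y := by
  simp [pairing]

lemma pairing_add_right (a : X ⟶ C.dual X) (x y y' : C.cat.space X) :
    pairing a x (y + y') = pairing a x y + pairing a x y' := by
  simp [pairing]

lemma pairing_zero_left (a : X ⟶ C.dual X) (y : C.cat.space X) : pairing a 0 y = 0 := by
  simp [pairing]

lemma pairing_transpose (a : X ⟶ C.dual X) (x y : C.cat.space X) :
    pairing (transpose a) x y = star (pairing a y x) := by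
  simp [pairing, transpose, C.dualMap_apply, C.toBidual_apply]

lemma IsHermitian.pairing_symm {a : X ⟶ C.dual X} (ha : IsHermitian a) (x y : C.cat.space X) :
    pairing a x y = star (pairing a y x) := by
  conv_lhs => rw [← (show transpose a = a from ha)]
  exact pairing_transpose a x y

lemma Congruent.symm {a : X ⟶ C.dual X} {b : Y ⟶ C.dual Y} (h : Congruent a b) :
    Congruent b a := by
  obtain ⟨f, rfl⟩ := h
  exact ⟨f.symm, form_ext fun x y => by simp [pairing, C.dualMap_apply]⟩

lemma Congruent.trans {a : X ⟶ C.dual X} {b : Y ⟶ C.dual Y} {c : Z ⟶ C.dual Z}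
    (h : Congruent a b) (h' : Congruent b c) : Congruent a c := by
  obtain ⟨f, rfl⟩ := h
  obtain ⟨g, rfl⟩ := h'
  exact ⟨f ≪≫ g, form_ext fun x y => by simp [pairing, C.dualMap_apply]⟩

lemma Congruent.of_neg {a : X ⟶ C.dual X} {b : Y ⟶ C.dual Y} (h : Congruent (-a) (-b)) :
    Congruent a b := by
  obtain ⟨f, hf⟩ := h
  exact ⟨f, neg_injective (by simpa using hf)⟩

lemma Congruent.isIso {a : X ⟶ C.dual X} {b : Y ⟶ C.dual Y} (h : Congruent a b) [IsIso b] :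
    IsIso a := by
  obtain ⟨f, rfl⟩ := h
  infer_instance

/-! ### Forms as operators on a Hilbert space -/

variable {E : Type v} [NormedAddCommGroup E] [InnerProductSpace ℂ E]

/-- The isomorphism `e` onto `E` carries the form `θ` into the scalar product of `E`. -/
def IsHilbertModel (θ : X ⟶ C.dual X) (e : C.cat.space X ≃L[ℂ] E) : Prop :=
  ∀ x y, pairing θ x y = inner ℂ (e y) (e x)

lemma exists_isHilbertModel (X : C.cat.Obj) : ∃ (θ : X ≅ C.dual X) (E : Type v)
    (_ : NormedAddCommGroup E) (_ : InnerProductSpace ℂ E) (_ : CompleteSpace E)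
    (e : C.cat.space X ≃L[ℂ] E), IsHilbertModel θ.hom e := by
  obtain ⟨θ, E, h1, h2, h3, e, he⟩ := C.exists_admissible X
  exact ⟨θ, E, h1, h2, h3, e, he⟩

section Model

variable {θ : X ≅ C.dual X} {e : C.cat.space X ≃L[ℂ] E}

lemma pairing_comp_inv (a : Y ⟶ C.dual X) (y : C.cat.space Y) (x : C.cat.space X) :
    pairing θ.hom (toCLM (a ≫ θ.inv) y) x = C.dualEquiv X (toCLM a y) x := by
  simp [pairing]

/-- The operator on the Hilbert space `E` that represents a form. -/
def formOperator (θ : X ≅ C.dual X) (e : C.cat.space X ≃L[ℂ] E) (a : X ⟶ C.dual X) : E →L[ℂ] E :=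
  (e : C.cat.space X →L[ℂ] E) ∘L toCLM (a ≫ θ.inv) ∘L (e.symm : E →L[ℂ] C.cat.space X)

lemma IsHilbertModel.inner_formOperator (he : IsHilbertModel θ.hom e) (a : X ⟶ C.dual X)
    (x y : C.cat.space X) : inner ℂ (e y) (formOperator θ e a (e x)) = pairing a x y := by
  have := he (toCLM (a ≫ θ.inv) x) y
  rw [pairing_comp_inv] at this
  simpa [formOperator, pairing] using this.symm

lemma bijective_formOperator {a : X ⟶ C.dual X} (ha : Function.Bijective (toCLM a)) :
    Function.Bijective (formOperator θ e a) :=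
  e.bijective.comp (((bijective_toCLM θ.inv).comp ha).comp e.symm.bijective)

variable [CompleteSpace E]

/-- The operators on the Hilbert space `E` that correspond to endomorphisms of `X`. -/
def endAlgebra (he : IsHilbertModel θ.hom e) : StarSubalgebra ℂ (E →L[ℂ] E) where
  carrier := {T | (e.symm : E →L[ℂ] C.cat.space X) ∘L T ∘L (e : C.cat.space X →L[ℂ] E) ∈
    C.cat.homSpace X X}
  mul_mem' {S T} hS hT := by
    change _ ∈ C.cat.homSpace X X
    convert C.cat.comp_mem hT hS using 1
    ext x; simp
  add_mem' {S T} hS hT := by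
    change _ ∈ C.cat.homSpace X X
    convert (C.cat.homSpace X X).add_mem hS hT using 1
    ext x; simp
  algebraMap_mem' c := by
    change _ ∈ C.cat.homSpace X X
    convert (C.cat.homSpace X X).smul_mem c (C.cat.id_mem X) using 1
    ext x; simp [Algebra.algebraMap_eq_smul_one]
  star_mem' {T} hT := by
    let f : X ⟶ X := ⟨_, hT⟩
    have hf (x) : e (toCLM f x) = T (e x) := by simp [f, toCLM]
    change _ ∈ C.cat.homSpace X X
    -- The Hilbert space adjoint is the categorical adjoint conjugated by `θ`, hence a morphism.
    convert (θ.hom ≫ C.dualMap f ≫ θ.inv).2 using 1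
    ext x
    change e.symm (star T (e x)) = toCLM (θ.hom ≫ C.dualMap f ≫ θ.inv) x
    rw [ContinuousLinearEquiv.symm_apply_eq]
    refine ext_inner_left ℂ fun z => ?_
    obtain ⟨y, rfl⟩ := e.surjective z
    rw [← he, ← Category.assoc, pairing_comp_inv, toCLM_comp, C.dualMap_apply]
    have := he x (toCLM f y)
    rw [hf] at this
    rw [star_eq_adjoint, adjoint_inner_right, ← this]
    rfl

lemma mem_endAlgebra {he : IsHilbertModel θ.hom e} {T : E →L[ℂ] E} :
    T ∈ endAlgebra he ↔ ∃ f : X ⟶ X, ∀ x, e (toCLM f x) = T (e x) := by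
  refine ⟨fun hT => ⟨⟨_, hT⟩, fun x => by simp [toCLM]⟩, fun ⟨f, hf⟩ => ?_⟩
  change _ ∈ C.cat.homSpace X X
  convert f.2 using 1
  ext x
  exact e.symm_apply_eq.2 (hf x).symm

/-- Norm convergence implies weak operator convergence, so weak closedness of the morphism space
pulls back. -/
lemma isClosed_endAlgebra (he : IsHilbertModel θ.hom e) :
    IsClosed (endAlgebra he : Set (E →L[ℂ] E)) := by
  let F : (E →L[ℂ] E) → (C.cat.space X →WOT[ℂ] C.cat.space X) := fun T =>
    .ofCLM ((e.symm : E →L[ℂ] C.cat.space X) ∘L T ∘L (e : C.cat.space X →L[ℂ] E))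
  have hF : Continuous F := by
    refine ContinuousLinearMapWOT.continuous_of_dual_apply_continuous fun x y => ?_
    change Continuous fun T : E →L[ℂ] E => y (e.symm (T (e x)))
    fun_prop
  exact (C.isClosed_homSpace X X).preimage hF

lemma formOperator_mem (he : IsHilbertModel θ.hom e) (a : X ⟶ C.dual X) :
    formOperator θ e a ∈ endAlgebra he :=
  mem_endAlgebra.2 ⟨a ≫ θ.inv, fun x => by simp [formOperator]⟩

/-- An invertible operator of the closed star algebra of endomorphisms comes from an
automorphism. -/
lemma exists_iso_of_isUnit (he : IsHilbertModel θ.hom e) {T : E →L[ℂ] E}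
    (hT : T ∈ endAlgebra he) (hu : IsUnit T) :
    ∃ f : X ≅ X, ∀ x, e (toCLM f.hom x) = T (e x) := by
  have : IsClosed (endAlgebra he : Set (E →L[ℂ] E)) := isClosed_endAlgebra he
  -- Spectral permanence: a closed star subalgebra contains the inverses of its elements that are
  -- invertible in the whole algebra.
  have hu' : IsUnit (⟨T, hT⟩ : endAlgebra he) := (StarSubalgebra.coe_isUnit (endAlgebra he)).1 hu
  obtain ⟨R, hR, hR'⟩ := isUnit_iff_exists.1 hu'
  obtain ⟨f, hf⟩ := mem_endAlgebra.1 hT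
  obtain ⟨g, hg⟩ := mem_endAlgebra.1 R.2
  refine ⟨⟨f, g, hom_ext fun x => e.injective ?_, hom_ext fun x => e.injective ?_⟩, hf⟩
  · rw [toCLM_comp, hg, hf]
    exact DFunLike.congr_fun (congrArg Subtype.val hR') (e x)
  · rw [toCLM_comp, hf, hg]
    exact DFunLike.congr_fun (congrArg Subtype.val hR) (e x)

/-- A positively definite bijective form is congruent to every admissible scalar product. -/
lemma IsPosDef.congruent_of_isHilbertModel (he : IsHilbertModel θ.hom e) {a : X ⟶ C.dual X}
    (ha : IsPosDef a) (hb : Function.Bijective (toCLM a)) : Congruent a θ.hom := by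
  set T := formOperator θ e a with hT
  have hpos : 0 ≤ T := by
    rw [nonneg_iff_isPositive, isPositive_iff_complex]
    intro z
    obtain ⟨x, rfl⟩ := e.surjective z
    rw [← inner_conj_symm, he.inner_formOperator]
    rcases eq_or_ne x 0 with rfl | hx
    · simp [pairing_zero_left]
    · obtain ⟨r, hr, h⟩ := ha x hx
      simp [h, hr.le]
  -- The congruence is `√T`, because `⟨√T x, √T y⟩ = ⟨T x, y⟩`.
  have hu : IsUnit (CFC.sqrt T) := by
    rw [CFC.isUnit_sqrt_iff T hpos, ContinuousLinearMap.isUnit_iff_bijective]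
    exact bijective_formOperator hb
  have hmem : CFC.sqrt T ∈ endAlgebra he := by
    have : IsClosed (endAlgebra he : Set (E →L[ℂ] E)) := isClosed_endAlgebra he
    rw [CFC.sqrt_eq_cfc, cfc_nnreal_eq_real _ T]
    exact cfc_mem (𝕜' := ℂ) _ (formOperator_mem he a)
  obtain ⟨q, hq⟩ := exists_iso_of_isUnit he hmem hu
  refine ⟨q, form_ext fun x y => ?_⟩
  have hsa : adjoint (CFC.sqrt T) = CFC.sqrt T :=
    (IsSelfAdjoint.of_nonneg (CFC.sqrt_nonneg T)).star_eq
  rw [pairing_pullback, he, hq, hq, ← adjoint_inner_right, hsa, ← he.inner_formOperator, ← hT]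
  conv_lhs => rw [← CFC.sqrt_mul_sqrt_self T hpos]
  rfl

end Model

/-- Bijectivity alone does not put the inverse in the category; congruence to an isomorphism does.
-/
lemma IsPosDef.isIso {a : X ⟶ C.dual X} (ha : IsPosDef a)
    (hb : Function.Bijective (toCLM a)) : IsIso a := by
  obtain ⟨θ, E, _, _, _, e, he⟩ := exists_isHilbertModel X
  exact (ha.congruent_of_isHilbertModel he hb).isIso

/-- A positively definite isomorphic form is itself an admissible scalar product. -/
lemma IsPosDef.exists_isHilbertModel {a : X ⟶ C.dual X} (ha : IsPosDef a) [IsIso a] :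
    ∃ (E : Type v) (_ : NormedAddCommGroup E) (_ : InnerProductSpace ℂ E) (_ : CompleteSpace E)
      (e : C.cat.space X ≃L[ℂ] E), IsHilbertModel a e := by
  obtain ⟨θ, E, h1, h2, h3, e, he⟩ := VonNeumannCategory.exists_isHilbertModel X
  obtain ⟨q, hq⟩ := ha.congruent_of_isHilbertModel he (bijective_toCLM a)
  let q' : C.cat.space X ≃L[ℂ] C.cat.space X :=
    .equivOfInverse (toCLM q.hom) (toCLM q.inv) (toCLM_hom_inv q) (toCLM_inv_hom q)
  refine ⟨E, h1, h2, h3, q'.trans e, fun x y => ?_⟩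
  rw [hq, pairing_pullback, he]
  rfl

/-- After pulling `b` back along `f`, both forms live on `X` and are congruent to the same scalar
product. -/
lemma Congruent.of_iso {a : X ⟶ C.dual X} {b : Y ⟶ C.dual Y} (ha : IsPosDef a) (hb : IsPosDef b)
    [IsIso a] [IsIso b] (f : X ≅ Y) : Congruent a b := by
  obtain ⟨θ, E, _, _, _, e, he⟩ := VonNeumannCategory.exists_isHilbertModel X
  have hb' : IsPosDef (f.hom ≫ b ≫ C.dualMap f.hom) := fun x hx => by
    rw [pairing_pullback]
    exact hb _ fun h => hx ((bijective_toCLM f.hom).1 (by rw [h, map_zero]))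
  exact (ha.congruent_of_isHilbertModel he (bijective_toCLM a)).trans
    ((hb'.congruent_of_isHilbertModel he (bijective_toCLM _)).symm.trans ⟨f, rfl⟩)

/-! ### Splitting of closed embeddings -/

/-- A closed embedding is a split monomorphism of the category. -/
lemma exists_retraction (f : X ⟶ Y) (hf : Topology.IsClosedEmbedding (toCLM f)) :
    ∃ r : Y ⟶ X, f ≫ r = 𝟙 X := by
  obtain ⟨θ, E, _, _, _, e, he⟩ := VonNeumannCategory.exists_isHilbertModel X
  obtain ⟨η, F, _, _, _, d, hd⟩ := VonNeumannCategory.exists_isHilbertModel Y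
  -- The scalar product of `Y` pulled back to `X`. Once `a` is invertible, `a⁻¹ f^* η` is a
  -- retraction.
  set a := f ≫ η.hom ≫ C.dualMap f with ha
  have hpair (x) : pairing a x x = ((‖d (toCLM f x)‖ ^ 2 : ℝ) : ℂ) := by
    rw [ha, pairing_pullback, hd, inner_self_eq_norm_sq_to_K]
    simp
  have hpos : IsPosDef a := fun x hx => by
    refine ⟨_, ?_, hpair x⟩
    have : d (toCLM f x) ≠ 0 := fun h =>
      hx (hf.injective (by rw [map_zero]; exact d.injective (by rw [h, map_zero])))
    positivity
  let g : E →L[ℂ] F :=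
    (d : C.cat.space Y →L[ℂ] F) ∘L toCLM f ∘L (e.symm : E →L[ℂ] C.cat.space X)
  have hg : Topology.IsClosedEmbedding g :=
    d.toHomeomorph.isClosedEmbedding.comp (hf.comp e.symm.toHomeomorph.isClosedEmbedding)
  obtain ⟨K, hK⟩ := g.antilipschitz_of_injective_of_isClosed_range hg.injective hg.isClosed_range
  have hu : IsUnit (formOperator θ e a) := by
    -- The embedding is bounded below with constant `K`, so the operator of `a` is coercive; `K + 1`
    -- replaces `K` to avoid a zero constant.
    refine ContinuousLinearMap.isUnit_of_forall_le_norm_inner_map _ (c := ((K + 1) ^ 2)⁻¹)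
      (by positivity) fun z => ?_
    obtain ⟨x, rfl⟩ := e.surjective z
    rw [norm_inner_symm, he.inner_formOperator, hpair, Complex.norm_real, Real.norm_of_nonneg
      (by positivity)]
    have h1 : ‖e x‖ ≤ K * ‖d (toCLM f x)‖ := by
      simpa [g] using hK.le_mul_norm_sub (x := e x) (y := 0)
    have h2 : ‖e x‖ ≤ (K + 1) * ‖d (toCLM f x)‖ :=
      h1.trans (by gcongr; simp)
    have h3 : ‖e x‖ ^ 2 ≤ ((K + 1) * ‖d (toCLM f x)‖) ^ 2 := by gcongr
    push_cast
    rw [← div_eq_mul_inv, div_le_iff₀ (by positivity)]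
    linarith
  have hbij : Function.Bijective (toCLM a) := by
    have h := ContinuousLinearMap.isUnit_iff_bijective.1 hu
    have h' : Function.Bijective (toCLM (a ≫ θ.inv)) := by
      have := (e.symm.bijective.comp h).comp e.bijective
      convert this using 1
      ext x; simp [formOperator]
    convert (bijective_toCLM θ.hom).comp h' using 1
    ext x; simp
  have := hpos.isIso hbij
  refine ⟨η.hom ≫ C.dualMap f ≫ inv a, ?_⟩
  rw [← Category.assoc η.hom, ← Category.assoc f, ← ha, IsIso.hom_inv_id]

/-! ### Existence of the decomposition -/

/-- An invertible self-adjoint operator has a spectral projection onto its positive part. -/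
lemma _root_.ContinuousLinearMap.exists_spectral_projection {E : Type*} [NormedAddCommGroup E]
    [InnerProductSpace ℂ E] [CompleteSpace E] (S : StarSubalgebra ℂ (E →L[ℂ] E))
    (hS : IsClosed (S : Set (E →L[ℂ] E))) {T : E →L[ℂ] E} (hT : IsSelfAdjoint T)
    (hu : IsUnit T) (hTS : T ∈ S) :
    ∃ p ∈ S, IsSelfAdjoint p ∧ p * p = p ∧ Commute p T ∧ 0 ≤ T * p ∧ 0 ≤ -T * (1 - p) := by
  have h0 : (0 : ℝ) ∉ spectrum ℝ T := (spectrum.zero_notMem_iff ℝ).2 hu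
  let s : ℝ → ℝ := fun x => if 0 < x then 1 else 0
  have hs : ContinuousOn s (spectrum ℝ T) := by
    refine ContinuousOn.mono (s := {0}ᶜ) (fun x hx => ContinuousAt.continuousWithinAt ?_)
      fun x hx => by rintro rfl; exact h0 hx
    rcases lt_or_gt_of_ne (show x ≠ 0 from hx) with h | h
    · refine (continuousAt_const (y := (0 : ℝ))).congr ?_
      filter_upwards [gt_mem_nhds h] with y hy
      simp [s, hy.not_gt]
    · refine (continuousAt_const (y := (1 : ℝ))).congr ?_
      filter_upwards [lt_mem_nhds h] with y hy
      simp [s, hy]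
  have hpos : T * cfc s T = cfc (fun x => x * s x) T := by
    rw [cfc_mul (fun x => x) s T continuousOn_id hs, cfc_id' ℝ T]
  have hneg : -T * (1 - cfc s T) = cfc (fun x => -x * (1 - s x)) T := by
    rw [cfc_mul (fun x => -x) (fun x => 1 - s x) T continuousOn_id.neg (continuousOn_const.sub hs),
      cfc_neg (fun x => x) T, cfc_sub (fun _ => 1) s T continuousOn_const hs, cfc_id' ℝ T,
      cfc_const_one ℝ T]
  refine ⟨cfc s T, cfc_mem (𝕜' := ℂ) s hTS, cfc_predicate s T, ?_, ?_, ?_, ?_⟩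
  · rw [← cfc_mul s s T hs hs]
    exact cfc_congr fun x _ => by simp [s]
  · have := cfc_commute_cfc s (fun x => x) T
    rwa [cfc_id' ℝ T] at this
  · rw [hpos]
    refine cfc_nonneg fun x _ => ?_
    by_cases hx : 0 < x
    · simp [s, hx, hx.le]
    · simp [s, hx]
  · rw [hneg]
    refine cfc_nonneg fun x _ => ?_
    by_cases hx : 0 < x
    · simp [s, hx]
    · simpa [s, hx] using not_lt.1 hx

lemma incl_mem (S : ClosedSubmodule X) (x : C.cat.space S.obj) :
    toCLM S.incl x ∈ S.subspace := ⟨x, rfl⟩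

/-- A non-degenerate Hermitian form splits into a positive and a negative part. -/
lemma exists_isPosNegDecomposition (φ : X ⟶ C.dual X) (hφ : IsHermitian φ) [IsIso φ] :
    ∃ P N : ClosedSubmodule X, IsPosNegDecomposition φ P N := by
  obtain ⟨θ, E, _, _, _, e, he⟩ := exists_isHilbertModel X
  set T := formOperator θ e φ with hT
  have hTi (x y) : inner ℂ (e y) (T (e x)) = pairing φ x y := he.inner_formOperator φ x y
  have hTinj : Function.Bijective T := bijective_formOperator (bijective_toCLM φ)
  have hsa : IsSelfAdjoint T := by
    rw [ContinuousLinearMap.isSelfAdjoint_iff_isSymmetric]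
    intro z w
    obtain ⟨x, rfl⟩ := e.surjective z
    obtain ⟨y, rfl⟩ := e.surjective w
    change inner ℂ (T (e x)) (e y) = inner ℂ (e x) (T (e y))
    rw [← inner_conj_symm, hTi, hTi, hφ.pairing_symm y x]
    rfl
  obtain ⟨p, hpS, hpsa, hpp, hcomm, hpos, hneg⟩ :=
    ContinuousLinearMap.exists_spectral_projection (endAlgebra he) (isClosed_endAlgebra he) hsa
      (ContinuousLinearMap.isUnit_iff_bijective.2 hTinj) (formOperator_mem he φ)
  obtain ⟨f, hf⟩ := mem_endAlgebra.1 hpS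
  obtain ⟨N, hN⟩ := C.exists_kernel f
  obtain ⟨P, hP⟩ := C.exists_kernel (𝟙 X - f)
  have hff (x) : toCLM f (toCLM f x) = toCLM f x := e.injective (by
    rw [hf, hf]; exact DFunLike.congr_fun hpp (e x))
  have memN (x) : x ∈ N.subspace ↔ toCLM f x = 0 := by rw [hN]; rfl
  have memP (x) : x ∈ P.subspace ↔ toCLM f x = x := by
    rw [hP, eq_comm (b := x), ← sub_eq_zero]; rfl
  -- For `A ≥ 0` one has `⟨A x, x⟩ = ‖√A x‖²`, which vanishes only if `A x = 0`; this gives strict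
  -- positivity.
  have hform (A : E →L[ℂ] E) (hA : 0 ≤ A) (x : C.cat.space X) (hx : x ≠ 0) (c : ℂ)
    (hAT : inner ℂ (e x) (A (e x)) = c) (hinj : A (e x) ≠ 0) : ∃ r : ℝ, 0 < r ∧ c = r := by
    have hq : adjoint (CFC.sqrt A) = CFC.sqrt A :=
      (IsSelfAdjoint.of_nonneg (CFC.sqrt_nonneg A)).star_eq
    have hqq : A (e x) = CFC.sqrt A (CFC.sqrt A (e x)) :=
      DFunLike.congr_fun (CFC.sqrt_mul_sqrt_self A hA).symm (e x)
    refine ⟨‖CFC.sqrt A (e x)‖ ^ 2, ?_, ?_⟩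
    · have : CFC.sqrt A (e x) ≠ 0 := fun h => hinj (by rw [hqq, h, map_zero])
      positivity
    · rw [← hAT, hqq, ← adjoint_inner_left, hq, inner_self_eq_norm_sq_to_K]
      simp
  refine ⟨P, N, ?_, fun x hx y hy => ?_, fun x hx => ?_, fun x hx => ?_⟩
  · refine ⟨Submodule.disjoint_def.2 fun x hx hx' => ?_,
      codisjoint_iff.2 (eq_top_iff.2 fun x _ => ?_)⟩
    · rw [← (memP x).1 hx, (memN x).1 hx']
    · exact Submodule.mem_sup.2 ⟨toCLM f x, (memP _).2 (hff x), x - toCLM f x,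
        (memN _).2 (by rw [map_sub, hff, sub_self]), by abel⟩
  · have h1 : p (e x) = e x := by rw [← hf, (memP x).1 hx]
    have h2 : p (e y) = 0 := by rw [← hf, (memN y).1 hy, map_zero]
    have h3 : T (e x) = p (T (e x)) := by
      conv_lhs => rw [← h1]
      exact (DFunLike.congr_fun hcomm (e x)).symm
    rw [← hTi, h3, ← adjoint_inner_left, show adjoint p = p from hpsa, h2, inner_zero_left]
  · have hx' : toCLM P.incl x ≠ 0 := fun h =>
      hx (P.isClosedEmbedding_incl.injective (by rw [h, map_zero]))
    have h1 : p (e (toCLM P.incl x)) = e (toCLM P.incl x) := by rw [← hf, (memP _).1 (incl_mem P x)]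
    have h2 : (T * p) (e (toCLM P.incl x)) = T (e (toCLM P.incl x)) := congrArg T h1
    refine hform _ hpos (toCLM P.incl x) hx' _ (by rw [h2, hTi, pairing_restrict]) fun h => ?_
    rw [h2] at h
    exact hx' (e.injective (hTinj.1 (by rw [h, map_zero, map_zero])))
  · have hx' : toCLM N.incl x ≠ 0 := fun h =>
      hx (N.isClosedEmbedding_incl.injective (by rw [h, map_zero]))
    have h1 : p (e (toCLM N.incl x)) = 0 := by rw [← hf, (memN _).1 (incl_mem N x), map_zero]
    have h2 : (-T * (1 - p)) (e (toCLM N.incl x)) = -T (e (toCLM N.incl x)) := by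
      simp [h1]
    refine hform _ hneg (toCLM N.incl x) hx' _
      (by rw [h2, inner_neg_right, hTi, pairing_neg, pairing_restrict]) fun h => ?_
    rw [h2, neg_eq_zero] at h
    exact hx' (e.injective (hTinj.1 (by rw [h, map_zero, map_zero])))

/-! ### Uniqueness of the decomposition -/

namespace IsPosNegDecomposition

variable {φ : X ⟶ C.dual X} {P N P' N' : ClosedSubmodule X}

lemma pairing_eq_zero (h : IsPosNegDecomposition φ P N) (hφ : IsHermitian φ) {x y : C.cat.space X}
    (hx : x ∈ N.subspace) (hy : y ∈ P.subspace) : pairing φ x y = 0 := by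
  rw [hφ.pairing_symm, h.orthogonal y hy x hx, star_zero]

lemma exists_add (h : IsPosNegDecomposition φ P N) (x : C.cat.space X) :
    ∃ (p : C.cat.space P.obj) (n : C.cat.space N.obj), toCLM P.incl p + toCLM N.incl n = x := by
  obtain ⟨_, ⟨p, rfl⟩, _, ⟨n, rfl⟩, hx⟩ :=
    Submodule.mem_sup.1 (h.isCompl.sup_eq_top ▸ Submodule.mem_top : x ∈ P.subspace ⊔ N.subspace)
  exact ⟨p, n, hx⟩

lemma pairing_add_incl (h : IsPosNegDecomposition φ P N) (hφ : IsHermitian φ)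
    (p q : C.cat.space P.obj) (n : C.cat.space N.obj) :
    pairing φ (toCLM P.incl p + toCLM N.incl n) (toCLM P.incl q) = pairing (restrict φ P) p q := by
  rw [pairing_add_left, h.pairing_eq_zero hφ (incl_mem N n) (incl_mem P q), add_zero, pairing_restrict]

/-- Definiteness gives injectivity. For surjectivity, extend a functional on `P` to `X` by a
retraction, represent it by `φ`, and keep the `P`-component: the `N`-component pairs to zero with
`P`. -/
lemma isIso_restrict (h : IsPosNegDecomposition φ P N) (hφ : IsHermitian φ) [IsIso φ] :
    IsIso (restrict φ P) := by
  refine h.posDef.isIso ⟨(injective_iff_map_eq_zero _).2 fun x hx => ?_, fun ψ => ?_⟩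
  · by_contra hne
    obtain ⟨r, hr, hxr⟩ := h.posDef x hne
    have : pairing (restrict φ P) x x = 0 := by simp [pairing, hx]
    rw [this, eq_comm, Complex.ofReal_eq_zero] at hxr
    exact hr.ne' hxr
  · obtain ⟨r, hr⟩ := exists_retraction P.incl P.isClosedEmbedding_incl
    obtain ⟨x, hx⟩ := (bijective_toCLM φ).2 (toCLM (C.dualMap r) ψ)
    obtain ⟨p, n, rfl⟩ := h.exists_add x
    refine ⟨p, dual_ext fun q => ?_⟩
    change pairing (restrict φ P) p q = _
    rw [← h.pairing_add_incl hφ p q n, pairing, hx, C.dualMap_apply, ← toCLM_comp, hr, toCLM_id]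

lemma neg (h : IsPosNegDecomposition φ P N) (hφ : IsHermitian φ) :
    IsPosNegDecomposition (-φ) N P where
  isCompl := h.isCompl.symm
  orthogonal x hx y hy := by rw [pairing_neg, h.pairing_eq_zero hφ hx hy, neg_zero]
  posDef := by simpa [restrict, IsNegDef] using h.negDef
  negDef := by simpa [restrict, IsNegDef] using h.posDef

/-- The projection along the negative part embeds every positive part into every other one. -/
lemma exists_isClosedEmbedding (h : IsPosNegDecomposition φ P N)
    (h' : IsPosNegDecomposition φ P' N') (hφ : IsHermitian φ) [IsIso φ] :
    ∃ f : P'.obj ⟶ P.obj, Topology.IsClosedEmbedding (toCLM f) := by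
  have := h.isIso_restrict hφ
  have := h'.isIso_restrict hφ
  -- The projection to `P` along `N`, written through `φ` so that it is visibly a morphism.
  let f := P'.incl ≫ φ ≫ C.dualMap P.incl ≫ inv (restrict φ P)
  have hf (x y) : pairing (restrict φ P) (toCLM f x) y
      = pairing φ (toCLM P'.incl x) (toCLM P.incl y) := by
    have : f ≫ restrict φ P = P'.incl ≫ φ ≫ C.dualMap P.incl := by simp [f]
    rw [pairing, ← toCLM_comp, this, toCLM_comp, toCLM_comp, C.dualMap_apply, pairing]
  obtain ⟨E, _, _, _, e, he⟩ := h.posDef.exists_isHilbertModel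
  obtain ⟨F, _, _, _, d, hd⟩ := h'.posDef.exists_isHilbertModel
  have hle (x) : ‖d x‖ ≤ ‖e (toCLM f x)‖ := by
    obtain ⟨p, n, hpn⟩ := h.exists_add (toCLM P'.incl x)
    have hfx : toCLM f x = p := (bijective_toCLM (restrict φ P)).1 <| dual_ext fun q => by
      change pairing (restrict φ P) _ q = pairing (restrict φ P) p q
      rw [hf, ← hpn, h.pairing_add_incl hφ]
    have hn : ∃ r : ℝ, 0 ≤ r ∧ pairing (restrict φ N) n n = -r := by
      rcases eq_or_ne n 0 with rfl | hn
      · exact ⟨0, le_rfl, by simp [pairing_zero_left]⟩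
      · obtain ⟨r, hr, h1⟩ := h.negDef n hn
        exact ⟨r, hr.le, by rw [← h1, pairing_neg, neg_neg]⟩
    obtain ⟨r, hr, hnr⟩ := hn
    -- Dropping the `N`-component removes the nonpositive term `-r`, so `f` does not decrease norms.
    have key : pairing (restrict φ P') x x = pairing (restrict φ P) p p - r := by
      rw [pairing_restrict, ← hpn, pairing_add_right, h.pairing_add_incl hφ, pairing_add_left,
        h.orthogonal _ (incl_mem P p) _ (incl_mem N n), zero_add, ← pairing_restrict φ N, hnr]
      ring
    rw [hd, he, inner_self_eq_norm_sq_to_K, inner_self_eq_norm_sq_to_K] at key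
    have key' : ‖d x‖ ^ 2 = ‖e p‖ ^ 2 - r := by
      simp only [RCLike.ofReal_eq_complex_ofReal] at key
      exact_mod_cast key
    rw [hfx]
    exact (sq_le_sq₀ (norm_nonneg _) (norm_nonneg _)).1 (by linarith)
  let g : F →L[ℂ] E :=
    (e : C.cat.space P.obj →L[ℂ] E) ∘L toCLM f ∘L (d.symm : F →L[ℂ] C.cat.space P'.obj)
  have hg : Topology.IsClosedEmbedding g :=
    (g.antilipschitz_of_bound (K := 1) fun z => by simpa [g] using hle (d.symm z)).isClosedEmbedding
      g.uniformContinuous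
  refine ⟨f, ?_⟩
  convert e.symm.toHomeomorph.isClosedEmbedding.comp (hg.comp d.toHomeomorph.isClosedEmbedding)
    using 1
  ext x
  simp [g]

/-- A Cantor–Bernstein argument: finiteness forces `g ≫ f` to be onto, hence `f` too, and a
surjective split monomorphism is invertible. -/
lemma nonempty_iso (hC : C.IsFinite) (h : IsPosNegDecomposition φ P N)
    (h' : IsPosNegDecomposition φ P' N') (hφ : IsHermitian φ) [IsIso φ] :
    Nonempty (P.obj ≅ P'.obj) := by
  obtain ⟨f, hf⟩ := h.exists_isClosedEmbedding h' hφ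
  obtain ⟨g, hg⟩ := h'.exists_isClosedEmbedding h hφ
  have htop := hC P.obj ⟨P.obj, g ≫ f, hf.comp hg⟩ ⟨Iso.refl _⟩
  have hsurj : Function.Surjective (toCLM f) := fun y => by
    obtain ⟨x, hx⟩ : y ∈ ClosedSubmodule.subspace ⟨P.obj, g ≫ f, hf.comp hg⟩ :=
      htop ▸ Submodule.mem_top
    exact ⟨toCLM g x, hx⟩
  obtain ⟨r, hr⟩ := exists_retraction f hf
  refine ⟨⟨r, f, hom_ext fun x => ?_, hr⟩⟩
  obtain ⟨y, rfl⟩ := hsurj x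
  rw [toCLM_comp, ← toCLM_comp f r, hr]
  rfl

lemma congruent_restrict (hC : C.IsFinite) (h : IsPosNegDecomposition φ P N)
    (h' : IsPosNegDecomposition φ P' N') (hφ : IsHermitian φ) [IsIso φ] :
    Congruent (restrict φ P) (restrict φ P') := by
  obtain ⟨i⟩ := h.nonempty_iso hC h' hφ
  have := h.isIso_restrict hφ
  have := h'.isIso_restrict hφ
  exact .of_iso h.posDef h'.posDef i

end IsPosNegDecomposition

lemma IsHermitian.neg {φ : X ⟶ C.dual X} (hφ : IsHermitian φ) : IsHermitian (-φ) :=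
  form_ext fun x y => by
    rw [pairing_transpose, pairing_neg, pairing_neg, hφ.pairing_symm x y, star_neg]

end VonNeumannCategory

open HilbertianCategory VonNeumannCategory in
theorem proposition2p10 (C : VonNeumannCategory.{u, v}) (hC : C.IsFinite) (X : C.cat.Obj)
    (φ : X ⟶ C.dual X) (hφ : IsHermitian φ) (hnd : IsNondegenerate φ) :
    (∃ P N : ClosedSubmodule X, IsPosNegDecomposition φ P N) ∧
    ∀ P N P' N' : ClosedSubmodule X,
      IsPosNegDecomposition φ P N → IsPosNegDecomposition φ P' N' →
        Nonempty (P.obj ≅ P'.obj) ∧ Nonempty (N.obj ≅ N'.obj) ∧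
        Congruent (restrict φ P) (restrict φ P') ∧ Congruent (restrict φ N) (restrict φ N') := by
  have : IsIso φ := hnd
  have : IsIso (-φ) := ⟨-inv φ, by simp, by simp⟩
  refine ⟨exists_isPosNegDecomposition φ hφ, fun P N P' N' h h' => ?_⟩
  have hcongr := (h.neg hφ).congruent_restrict hC (h'.neg hφ) hφ.neg
  refine ⟨h.nonempty_iso hC h' hφ, (h.neg hφ).nonempty_iso hC (h'.neg hφ) hφ.neg,
    h.congruent_restrict hC h' hφ, Congruent.of_neg ?_⟩
  simpa [restrict] using hcongr
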